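/- Let $(S,\mathcal A)$ be a measurable space, let $Q$ be a Markov transition kernel on $S$ and let $\pi$ be a probability measure on $S$ that is invariant for $Q$, such that the stationary Markov chain $(\xi_n)_{n\ge 0}$ with transition kernel $Q$ and initial distribution $\pi$ is ergodic (that is, the shift on the path space is ergodic for its law). For $x\in S$ let $\mathbb{E}^x$ denote expectation with respect to the law of the chain started at $\xi_0=x$. Write $(Qf)(x)=\int_S f(s)\,Q(x,ds)$ and $S_k(f)=\sum_{i=1}^k f(\xi_i)$. Let $h:S\to\mathbb{R}$ be measurable with $\int_S h^2\,d\pi<\infty$ and $\int_S h\,d\pi=0$, and put $g_h=\sup_{n\ge 0}\bigl|\sum_{j=0}^n Q^j h\bigr|$, which takes values in $[0,\infty]$. If $\mathbb{E}_\pi|h g_h|=\int_S |h|\,g_h\,d\pi<\infty$ (with $0\cdot\infty=0$), then for $\pi$-almost every $x\in S$ $$\limsup_{n\to\infty}\frac{\mathbb{E}^x\bigl(\max_{1\le k\le n}S_k(h)^2\bigr)}{n}\le 24\,\mathbb{E}_\pi|h g_h|.$$ -/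

import Mathlib

open MeasureTheory ProbabilityTheory Filter
open scoped ENNReal

noncomputable section

namespace MarkovChain

variable {S : Type*} [MeasurableSpace S]

/-- One step of the chain with transition kernel `Q`, as a kernel from histories
`(ξ₀, …, ξₙ)` to the next state: the conditional law of `ξₙ₊₁` is `Q (ξₙ, ·)`. -/
def step (Q : Kernel S S) (n : ℕ) : Kernel ((i : Finset.Iic n) → S) S :=
  Q.comap (fun y => y ⟨n, Finset.mem_Iic.2 le_rfl⟩) (measurable_pi_apply _)

instance (Q : Kernel S S) [IsMarkovKernel Q] (n : ℕ) : IsMarkovKernel (step Q n) := by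
  unfold step; infer_instance

/-- The kernel `x ↦ ℙˣ`: `pathLaw Q x` is the law on `S^ℕ` (product σ-algebra) of the Markov
chain `(ξₙ)ₙ≥0` with transition kernel `Q` and `ξ₀ = x`. The variable `ξₙ` is the `n`-th
coordinate. -/
def pathLaw (Q : Kernel S S) [IsMarkovKernel Q] : Kernel S (ℕ → S) :=
  (Kernel.traj (X := fun _ => S) (step Q) 0).comap (fun x _ => x)
    (measurable_pi_lambda _ fun _ => measurable_id)

/-- The shift on `S^ℕ`. -/
def shift (ω : ℕ → S) : ℕ → S := fun n => ω (n + 1)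

/-- The chain with transition kernel `Q` and initial distribution `π` is (stationary and)
ergodic: the shift is ergodic for `ℙ^π = ∫ ℙˣ π(dx)`. -/
def IsErgodicChain (Q : Kernel S S) [IsMarkovKernel Q] (π : Measure S) : Prop :=
  Ergodic (shift (S := S)) (π.bind (pathLaw Q))

/-- The Markov operator `(Q f)(x) = ∫ f(s) Q(x, ds)`. -/
def markovOp (Q : Kernel S S) (f : S → ℝ) : S → ℝ := fun x => ∫ s, f s ∂(Q x)

/-- `f ∈ 𝕃ₚ⁰(π)`: a measurable function with `∫ |f|ᵖ dπ < ∞` and `∫ f dπ = 0`. -/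
def MemLp0 (f : S → ℝ) (p : ℝ≥0∞) (π : Measure S) : Prop :=
  Measurable f ∧ MemLp f p π ∧ ∫ x, f x ∂π = 0

/-- `g_f = sup_{n ≥ 0} |∑_{j=0}^n Q^j f|`, with values in `[0, ∞]`. -/
def supPotential (Q : Kernel S S) (f : S → ℝ) (x : S) : ℝ≥0∞ :=
  ⨆ n : ℕ, ENNReal.ofReal |∑ j ∈ Finset.range (n + 1), (markovOp Q)^[j] f x|

/-- `S_n(f) = ∑_{i=1}^n f(ξ_i)`. -/
def partialSum (f : S → ℝ) (n : ℕ) (ω : ℕ → S) : ℝ := ∑ i ∈ Finset.Icc 1 n, f (ω i)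

/-- `max_{1 ≤ k ≤ n} S_k(f)²`, as an element of `[0, ∞]`. -/
def maxSqSum (f : S → ℝ) (n : ℕ) (ω : ℕ → S) : ℝ≥0∞ :=
  (Finset.Icc 1 n).sup fun k => ENNReal.ofReal (partialSum f k ω ^ 2)

end MarkovChain

end

/-!
The proof combines a maximal inequality under `ℙˣ` with Hopf's ergodic theorem for `Q`.

For real numbers `xₖ` with partial sums `sₖ` let `Mₙ = max (0, s₁, …, sₙ)`. Since `M` only increases
at times where it equals `s`, one has `Mₙ² ≤ 4 sₙ² - 4 ∑ Mₖ xₖ` (`runMax_sq_le`), and by Abel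
summation the right side is a sum of terms `4 xₖ² + (8 xₖ - 4 dₖ)(sₙ - sₖ₊₁)`, where `sₖ₊₁` includes
`xₖ` and the increment `dₖ` of `M` lies between `0` and the positive part of `xₖ`. For an adapted
sequence the future sum may be replaced by its conditional expectation, and `four_mul_sq_add_le`
gives `𝔼 Mₙ² ≤ 8 ∑ 𝔼 |Xₖ 𝔼(Xₖ + ⋯ + Xₙ₋₁ | ℱₖ)|` (`integral_runMax_sq_le`, in the style of Dedecker
and Rio). For `Xₖ = h(ξₖ₊₁)` the conditional expectation is a sum `∑ Qʲ h` at `ξₖ₊₁`, bounded by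
`g_h`. Applied to `h` and `-h` this yields, for almost every `x`,
`𝔼ˣ max Sₖ(h)² ≤ 16 ∑_{k=1}^n Qᵏ(|h| g_h)(x)` (`ae_lintegral_maxSqSum_le`), so the constant `24` has
room to spare.

It remains to see that the averages of `Qᵏ φ` are asymptotically at most `∫ φ dπ`, almost
everywhere, for integrable `φ ≥ 0` (`ae_limsup_sum_lmarkovOp_div_le`). Birkhoff's theorem on the path space does
not give this, since expectations under `ℙˣ` of ergodic averages need not be dominated. Instead, `φ`
is truncated and averaged over a long fixed time; by the mean ergodic theorem for the shift the
result is a constant at most `∫ φ dπ` up to an error `u` of small integral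
(`exists_sum_lmarkovOp_le`), and the ergodic sums of `u` are controlled by the maximal ergodic
inequality for `Q` (`mul_measure_exists_lt_sum_le`).
-/

/-! ### A maximal inequality for the square of partial sums -/

/-- The running maximum `max (0, s₁, …, sₙ)` of the partial sums `sₖ = x₀ + ⋯ + xₖ₋₁`. -/
noncomputable def runMax (x : ℕ → ℝ) : ℕ → ℝ
  | 0 => 0
  | n + 1 => max (runMax x n) (∑ i ∈ Finset.range (n + 1), x i)

lemma runMax_le_succ (x : ℕ → ℝ) (n : ℕ) : runMax x n ≤ runMax x (n + 1) := le_max_left _ _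

lemma sum_le_runMax (x : ℕ → ℝ) (n : ℕ) : ∑ i ∈ Finset.range n, x i ≤ runMax x n := by
  cases n with
  | zero => simp [runMax]
  | succ n => exact le_max_right _ _

lemma runMax_mono (x : ℕ → ℝ) : Monotone (runMax x) := monotone_nat_of_le_succ (runMax_le_succ x)

lemma runMax_succ_sub_le (x : ℕ → ℝ) (n : ℕ) :
    runMax x (n + 1) - runMax x n ≤ max (x n) 0 := by
  have h := sum_le_runMax x n
  rw [sub_le_iff_le_add, runMax, Finset.sum_range_succ]
  refine max_le ?_ ?_
  · linarith [le_max_right (x n) 0]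
  · linarith [le_max_left (x n) 0]

lemma runMax_sq_le (x : ℕ → ℝ) (n : ℕ) :
    runMax x n ^ 2 ≤ 4 * (∑ i ∈ Finset.range n, x i) ^ 2
      - 4 * ∑ k ∈ Finset.range n, runMax x k * x k := by
  have key : runMax x n ^ 2 ≤ 2 * (∑ i ∈ Finset.range n, x i) * runMax x n
      - 2 * ∑ k ∈ Finset.range n, runMax x k * x k := by
    induction n with
    | zero => simp [runMax]
    | succ n ih =>
      rw [runMax, Finset.sum_range_succ (fun k => runMax x k * x k)]
      have hs := Finset.sum_range_succ x n
      rcases max_cases (runMax x n) (∑ i ∈ Finset.range (n + 1), x i) with ⟨h, _⟩ | ⟨h, _⟩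
      · rw [h, hs]; nlinarith
      · rw [h, hs]; nlinarith [sq_nonneg (∑ i ∈ Finset.range n, x i + x n - runMax x n)]
  nlinarith [sq_nonneg (runMax x n - 2 * ∑ i ∈ Finset.range n, x i)]

/-- Abel summation: the bound of `runMax_sq_le` as a sum over `k` of a function of `x₀, …, xₖ`
times the increment `sₙ - sₖ₊₁` of the future. -/
lemma four_mul_sum_sq_sub (x : ℕ → ℝ) (n : ℕ) :
    4 * (∑ i ∈ Finset.range n, x i) ^ 2 - 4 * ∑ k ∈ Finset.range n, runMax x k * x k
      = ∑ k ∈ Finset.range n, (4 * x k ^ 2 + (8 * x k - 4 * (runMax x (k + 1) - runMax x k)) *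
          ((∑ i ∈ Finset.Ico k n, x i) - x k)) := by
  induction n with
  | zero => simp
  | succ n ih =>
    have h1 : ∀ k ∈ Finset.range n,
        4 * x k ^ 2 + (8 * x k - 4 * (runMax x (k + 1) - runMax x k)) *
          ((∑ i ∈ Finset.Ico k (n + 1), x i) - x k)
        = (4 * x k ^ 2 + (8 * x k - 4 * (runMax x (k + 1) - runMax x k)) *
          ((∑ i ∈ Finset.Ico k n, x i) - x k))
          + (8 * x k * x n - 4 * (runMax x (k + 1) - runMax x k) * x n) := by
      intro k hk
      rw [Finset.sum_Ico_succ_top (Finset.mem_range.1 hk).le]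
      ring
    rw [Finset.sum_range_succ _ n, Finset.sum_range_succ _ n, Finset.sum_range_succ _ n,
      Finset.sum_congr rfl h1, Finset.sum_add_distrib, ← ih, Finset.sum_sub_distrib,
      ← Finset.sum_mul, ← Finset.sum_mul, ← Finset.mul_sum, ← Finset.mul_sum,
      Finset.sum_range_sub]
    simp [runMax]
    ring

/-- Bound for a term of `four_mul_sum_sq_sub`, with `G = sₙ - sₖ` or its conditional expectation.
The weight `8 x - 4 d` of `G` lies between `4 x` and `8 x` for `x ≥ 0` and is `8 x` for `x ≤ 0`,
so that `4 x² - (8 x - 4 d) x ≤ 0`. -/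
lemma four_mul_sq_add_le {x d : ℝ} (hd : 0 ≤ d) (hdx : d ≤ max x 0) (G : ℝ) :
    4 * x ^ 2 + (8 * x - 4 * d) * (G - x) ≤ 8 * (|x| * |G|) := by
  have h1 : d * x ≤ x ^ 2 := by
    rcases le_total 0 x with hx | hx
    · rw [max_eq_left hx] at hdx; nlinarith
    · nlinarith
  have h2 : |8 * x - 4 * d| ≤ 8 * |x| := by
    rcases le_total 0 x with hx | hx
    · rw [max_eq_left hx] at hdx
      rw [abs_of_nonneg hx, abs_of_nonneg] <;> linarith
    · rw [max_eq_right hx] at hdx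
      have : d = 0 := le_antisymm hdx hd
      subst this
      rw [abs_of_nonpos hx, abs_of_nonpos] <;> linarith
  have h3 : (8 * x - 4 * d) * G ≤ 8 * |x| * |G| := by
    refine (le_abs_self _).trans ?_
    rw [abs_mul]
    exact mul_le_mul_of_nonneg_right h2 (abs_nonneg _)
  nlinarith

section Maximal

variable {Ω : Type*} {m0 : MeasurableSpace Ω} {μ : Measure Ω}
  {ℱ : Filtration ℕ m0} {X : ℕ → Ω → ℝ}

lemma stronglyMeasurable_sum_range {m : MeasurableSpace Ω} {n : ℕ}
    (hX : ∀ k < n, StronglyMeasurable[m] (X k)) :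
    StronglyMeasurable[m] fun ω => ∑ i ∈ Finset.range n, X i ω :=
  Finset.stronglyMeasurable_fun_sum _ fun k hk => hX k (Finset.mem_range.1 hk)

lemma stronglyMeasurable_runMax {m : MeasurableSpace Ω} {n : ℕ}
    (hX : ∀ k < n, StronglyMeasurable[m] (X k)) :
    StronglyMeasurable[m] fun ω => runMax (fun i => X i ω) n := by
  induction n with
  | zero => exact stronglyMeasurable_const
  | succ n ih =>
    exact (ih fun k hk => hX k (hk.trans n.lt_succ_self)).sup (stronglyMeasurable_sum_range hX)

lemma memLp_runMax {p : ℝ≥0∞} (hX : ∀ k, MemLp (X k) p μ) (n : ℕ) :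
    MemLp (fun ω => runMax (fun i => X i ω) n) p μ := by
  induction n with
  | zero => exact MemLp.zero
  | succ n ih => exact ih.sup (memLp_finsetSum _ fun k _ => hX k)

/-- **Maximal inequality** for adapted square integrable sequences: only the conditional
expectations of the future sums `Xₖ + ⋯ + Xₙ₋₁` given the past up to time `k` enter the bound.
The weight that multiplies the future sum in `four_mul_sum_sq_sub` is known at time `k`, so the
sum may be replaced by its conditional expectation. -/
theorem integral_runMax_sq_le [IsFiniteMeasure μ] (hX : ∀ k, StronglyMeasurable[ℱ k] (X k))
    (hX2 : ∀ k, MemLp (X k) 2 μ) (n : ℕ) :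
    ∫ ω, runMax (fun i => X i ω) n ^ 2 ∂μ ≤
      ∑ k ∈ Finset.range n, 8 * ∫ ω, |X k ω| *
        |(μ[fun ω => ∑ i ∈ Finset.Ico k n, X i ω | ℱ k]) ω| ∂μ := by
  set T : ℕ → Ω → ℝ := fun k ω => ∑ i ∈ Finset.Ico k n, X i ω with hT
  set Y : ℕ → Ω → ℝ := fun k ω =>
    8 * X k ω - 4 * (runMax (fun i => X i ω) (k + 1) - runMax (fun i => X i ω) k) with hY
  have hT2 : ∀ k, MemLp (T k) 2 μ := fun k => memLp_finsetSum _ fun i _ => hX2 i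
  have hY2 : ∀ k, MemLp (Y k) 2 μ := fun k =>
    ((hX2 k).const_mul 8).sub (((memLp_runMax hX2 (k + 1)).sub (memLp_runMax hX2 k)).const_mul 4)
  have hYm : ∀ k, StronglyMeasurable[ℱ k] (Y k) := fun k => by
    have h1 : ∀ i < k + 1, StronglyMeasurable[ℱ k] (X i) := fun i hi =>
      (hX i).mono (ℱ.mono (Nat.lt_succ_iff.1 hi))
    exact ((hX k).const_mul 8).sub (((stronglyMeasurable_runMax h1).sub
      (stronglyMeasurable_runMax fun i hi => h1 i (hi.trans k.lt_succ_self))).const_mul 4)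
  have hC2 : ∀ k, MemLp (μ[T k | ℱ k]) 2 μ := fun k => (hT2 k).condExp one_le_two
  have hYT : ∀ k, Integrable (fun ω => Y k ω * T k ω) μ := fun k => (hY2 k).integrable_mul (hT2 k)
  have hYC : ∀ k, Integrable (fun ω => Y k ω * (μ[T k | ℱ k]) ω) μ := fun k =>
    (hY2 k).integrable_mul (hC2 k)
  have hXX : ∀ k, Integrable (fun ω => 4 * X k ω ^ 2 - Y k ω * X k ω) μ := fun k =>
    ((hX2 k).integrable_sq.const_mul 4).sub ((hY2 k).integrable_mul (hX2 k))
  have hI : ∀ k, Integrable (fun ω => (4 * X k ω ^ 2 - Y k ω * X k ω) + Y k ω * T k ω) μ :=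
    fun k => (hXX k).add (hYT k)
  have hcond : ∀ k, ∫ ω, Y k ω * T k ω ∂μ = ∫ ω, Y k ω * (μ[T k | ℱ k]) ω ∂μ := fun k => by
    rw [← integral_condExp (ℱ.le k)]
    exact integral_congr_ae (condExp_mul_of_stronglyMeasurable_left (hYm k) (hYT k)
      ((hT2 k).integrable one_le_two))
  calc ∫ ω, runMax (fun i => X i ω) n ^ 2 ∂μ
      ≤ ∫ ω, ∑ k ∈ Finset.range n, ((4 * X k ω ^ 2 - Y k ω * X k ω) + Y k ω * T k ω) ∂μ := by
        refine integral_mono (memLp_runMax hX2 n).integrable_sq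
          (integrable_finsetSum _ fun k _ => hI k) fun ω => ?_
        refine (runMax_sq_le (fun i => X i ω) n).trans ?_
        rw [four_mul_sum_sq_sub]
        exact Finset.sum_le_sum fun k _ => le_of_eq (by simp only [hY, hT]; ring)
    _ = ∑ k ∈ Finset.range n,
          ∫ ω, ((4 * X k ω ^ 2 - Y k ω * X k ω) + Y k ω * (μ[T k | ℱ k]) ω) ∂μ := by
        rw [integral_finsetSum _ fun k _ => hI k]
        refine Finset.sum_congr rfl fun k _ => ?_
        rw [integral_add (hXX k) (hYT k), integral_add (hXX k) (hYC k), hcond]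
    _ ≤ _ := by
        refine Finset.sum_le_sum fun k _ => ?_
        rw [← integral_const_mul]
        refine integral_mono ((hXX k).add (hYC k))
          (((hX2 k).abs.integrable_mul (hC2 k).abs).const_mul 8) fun ω => ?_
        refine le_trans (le_of_eq ?_) (four_mul_sq_add_le
          (sub_nonneg.2 (runMax_le_succ (fun i => X i ω) k))
          (runMax_succ_sub_le (fun i => X i ω) k) ((μ[T k | ℱ k]) ω))
        simp only [hY]
        ring

end Maximal

namespace MarkovChain

/-! ### The law of the chain -/

variable {S : Type*} [MeasurableSpace S] (Q : Kernel S S)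

/-- The Markov operator on functions with values in `[0, ∞]`. -/
noncomputable def lmarkovOp (u : S → ℝ≥0∞) : S → ℝ≥0∞ := fun x => ∫⁻ s, u s ∂(Q x)

variable {Q}

lemma measurable_lmarkovOp {u : S → ℝ≥0∞} (hu : Measurable u) : Measurable (lmarkovOp Q u) :=
  hu.lintegral_kernel

lemma measurable_lmarkovOp_iterate {u : S → ℝ≥0∞} (hu : Measurable u) (k : ℕ) :
    Measurable ((lmarkovOp Q)^[k] u) := by
  induction k generalizing u with
  | zero => exact hu
  | succ k ih => exact ih (measurable_lmarkovOp hu)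

lemma measurable_markovOp [IsMarkovKernel Q] {f : S → ℝ} (hf : Measurable f) :
    Measurable (markovOp Q f) :=
  (hf.stronglyMeasurable.integral_kernel).measurable

lemma measurable_markovOp_iterate [IsMarkovKernel Q] {f : S → ℝ} (hf : Measurable f) (k : ℕ) :
    Measurable ((markovOp Q)^[k] f) := by
  induction k generalizing f with
  | zero => exact hf
  | succ k ih => exact ih (measurable_markovOp hf)

section Invariant

variable {π : Measure S}

lemma lintegral_lmarkovOp (hinv : Kernel.Invariant Q π) {u : S → ℝ≥0∞} (hu : Measurable u) :
    ∫⁻ x, lmarkovOp Q u x ∂π = ∫⁻ x, u x ∂π := by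
  conv_rhs => rw [← hinv.def]
  rw [Measure.lintegral_bind Q.aemeasurable hu.aemeasurable]
  rfl

lemma lintegral_lmarkovOp_iterate (hinv : Kernel.Invariant Q π) {u : S → ℝ≥0∞}
    (hu : Measurable u) (k : ℕ) : ∫⁻ x, (lmarkovOp Q)^[k] u x ∂π = ∫⁻ x, u x ∂π := by
  induction k generalizing u with
  | zero => rfl
  | succ k ih =>
    rw [Function.iterate_succ_apply, ih (measurable_lmarkovOp hu), lintegral_lmarkovOp hinv hu]

end Invariant

section PathLaw

variable [IsMarkovKernel Q]

instance : IsMarkovKernel (pathLaw Q) := by unfold pathLaw; infer_instance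

lemma pathLaw_apply (x : S) :
    pathLaw Q x = Kernel.traj (X := fun _ => S) (step Q) 0 (fun _ => x) := rfl

lemma lintegral_pathLaw_eval_zero {u : S → ℝ≥0∞} (hu : Measurable u) (x : S) :
    ∫⁻ ω, u (ω 0) ∂(pathLaw Q x) = u x := by
  have h := Kernel.traj_map_frestrictLe_apply (X := fun _ => S) (κ := step Q) 0 0 (fun _ => x)
  rw [Kernel.partialTraj_self, Kernel.id_apply] at h
  have h0 : Measurable fun y : (i : Finset.Iic 0) → S => u (y ⟨0, Finset.mem_Iic.2 le_rfl⟩) :=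
    hu.comp (measurable_pi_apply _)
  have h1 := lintegral_map (μ := pathLaw Q x) h0
    (Preorder.measurable_frestrictLe (X := fun _ : ℕ => S) 0)
  rw [pathLaw_apply, h, lintegral_dirac' _ h0] at h1
  exact h1.symm

lemma lintegral_pathLaw_eval_succ {u : S → ℝ≥0∞} (hu : Measurable u) (x : S) (k : ℕ) :
    ∫⁻ ω, u (ω (k + 1)) ∂(pathLaw Q x) = ∫⁻ ω, lmarkovOp Q u (ω k) ∂(pathLaw Q x) := by
  have h := Kernel.partialTraj_compProd_eq_map_traj (X := fun _ => S) (κ := step Q)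
    (Nat.zero_le k) (x₀ := fun _ => x)
  have hm : Measurable fun ω : ℕ → S =>
      (Preorder.frestrictLe (π := fun _ => S) k ω, ω (k + 1)) := by fun_prop
  have h1 := lintegral_map (μ := pathLaw Q x) (hu.comp measurable_snd) hm
  rw [pathLaw_apply, ← h, Measure.lintegral_compProd (hu.comp measurable_snd),
    ← Kernel.traj_map_frestrictLe_apply, lintegral_map _ (Preorder.measurable_frestrictLe k)] at h1
  · exact h1.symm
  · exact (hu.comp measurable_snd).lintegral_kernel_prod_right'

/-- The `k`-th coordinate has law `Qᵏ(x, ·)` under `ℙˣ`. -/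
lemma lintegral_pathLaw_eval {u : S → ℝ≥0∞} (hu : Measurable u) (x : S) (k : ℕ) :
    ∫⁻ ω, u (ω k) ∂(pathLaw Q x) = (lmarkovOp Q)^[k] u x := by
  induction k generalizing u with
  | zero => exact lintegral_pathLaw_eval_zero hu x
  | succ k ih =>
    rw [lintegral_pathLaw_eval_succ hu, ih (measurable_lmarkovOp hu), Function.iterate_succ_apply]

/-- **Markov property**, one step. -/
lemma condExp_pathLaw_succ {f : S → ℝ} (hf : Measurable f) (x : S) (k : ℕ)
    (hint : Integrable (fun ω : ℕ → S => f (ω (k + 1))) (pathLaw Q x)) :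
    (pathLaw Q x)[fun ω => f (ω (k + 1)) | Filtration.piLE (X := fun _ : ℕ => S) k]
      =ᵐ[pathLaw Q x] fun ω => markovOp Q f (ω k) := by
  refine (Kernel.condExp_traj (X := fun _ => S) (Nat.zero_le k) hint).trans
    (ae_of_all _ fun ω => ?_)
  have h : (Kernel.traj (X := fun _ => S) (step Q) k (Preorder.frestrictLe k ω)).map
      (fun ω => ω (k + 1)) = Q (ω k) := by
    rw [← Kernel.map_apply _ (measurable_pi_apply _), Kernel.map_traj_succ_self]
    rfl
  change _ = ∫ s, f s ∂(Q (ω k))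
  rw [← h, integral_map (measurable_pi_apply _).aemeasurable hf.aestronglyMeasurable]

/-- **Markov property**, `j` steps. -/
lemma condExp_pathLaw_add {f : S → ℝ} (hf : Measurable f) (x : S)
    (hint : ∀ i k, Integrable (fun ω : ℕ → S => (markovOp Q)^[i] f (ω k)) (pathLaw Q x))
    (k j : ℕ) :
    (pathLaw Q x)[fun ω => f (ω (k + j)) | Filtration.piLE (X := fun _ : ℕ => S) k]
      =ᵐ[pathLaw Q x] fun ω => (markovOp Q)^[j] f (ω k) := by
  induction j generalizing f with
  | zero =>
    have hm : StronglyMeasurable[Filtration.piLE (X := fun _ : ℕ => S) k]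
        fun ω : ℕ → S => f (ω k) := by
      rw [Filtration.piLE_eq_comap_frestrictLe]
      exact ((hf.comp (measurable_pi_apply ⟨k, Finset.mem_Iic.2 le_rfl⟩)).comp
        (comap_measurable (Preorder.frestrictLe (π := fun _ : ℕ => S) k))).stronglyMeasurable
    exact (condExp_of_stronglyMeasurable (Filtration.le _ k) hm (hint 0 k)).eventuallyEq
  | succ j ih =>
    have h1 := condExp_pathLaw_succ hf x (k + j) (hint 0 (k + j + 1))
    have h2 := condExp_condExp_of_le (μ := pathLaw Q x) (f := fun ω : ℕ → S => f (ω (k + j + 1)))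
      ((Filtration.piLE (X := fun _ : ℕ => S)).mono (Nat.le_add_right k j)) (Filtration.le _ _)
    refine h2.symm.trans ((condExp_congr_ae h1).trans ?_)
    exact ih (measurable_markovOp hf) fun i => hint (i + 1)

end PathLaw

end MarkovChain

/-! ### The mean ergodic theorem for an ergodic map -/

section MeanErgodic

open scoped Topology

/-- Von Neumann's theorem for the Koopman operator of an ergodic map: the fixed functions are the
constants, so the Birkhoff averages of a square integrable function converge to its mean, here in
the weaker sense of `L¹`. -/
theorem Ergodic.tendsto_lintegral_average_sub {Ω : Type*} [MeasurableSpace Ω] {μ : Measure Ω}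
    [IsProbabilityMeasure μ] {T : Ω → Ω} (hT : Ergodic T μ) {F : Ω → ℝ} (hF : MemLp F 2 μ) :
    Tendsto (fun N : ℕ => ∫⁻ ω, ‖(N : ℝ)⁻¹ * ∑ k ∈ Finset.range N, F (T^[k] ω) - ∫ ω, F ω ∂μ‖ₑ ∂μ)
      atTop (𝓝 0) := by
  have hTm := hT.toMeasurePreserving
  set A : ℕ → Ω → ℝ := fun N ω => (N : ℝ)⁻¹ * ∑ k ∈ Finset.range N, F (T^[k] ω) with hA
  have hFk : ∀ k, MemLp (fun ω => F (T^[k] ω)) 2 μ := fun k =>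
    hF.comp_measurePreserving (hTm.iterate k)
  have hA2 : ∀ N, MemLp (A N) 2 μ := fun N => (memLp_finsetSum _ fun k _ => hFk k).const_mul _
  set K := (Lp.compMeasurePreservingₗᵢ (E := ℝ) (p := 2) ℝ T hTm).toContinuousLinearMap
  have hKk : ∀ k, K^[k] (hF.toLp F) = (hFk k).toLp _ := fun k => by
    have := congrFun (Lp.compMeasurePreserving_iterate (E := ℝ) (p := 2) hTm k) (hF.toLp F)
    exact this
  have hlim := K.tendsto_birkhoffAverage_orthogonalProjection
    (LinearIsometry.norm_toContinuousLinearMap_le _) (hF.toLp F)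
  generalize (K.eqLocus (1 : Lp ℝ 2 μ →L[ℝ] Lp ℝ 2 μ)).orthogonalProjectionOnto (hF.toLp F) = q
    at hlim
  obtain ⟨p, hp⟩ := q
  have hbA : ∀ N, birkhoffAverage ℝ K id N (hF.toLp F) = (hA2 N).toLp (A N) := fun N => by
    apply Lp.ext
    have h1 : ∀ᵐ ω ∂μ, ∀ k, (K^[k] (hF.toLp F) : Lp ℝ 2 μ) ω = F (T^[k] ω) :=
      ae_all_iff.2 fun k => by rw [hKk]; exact (hFk k).coeFn_toLp
    rw [birkhoffAverage, birkhoffSum]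
    filter_upwards [h1, (hA2 N).coeFn_toLp,
      Lp.coeFn_smul (N : ℝ)⁻¹ (∑ k ∈ Finset.range N, (id (K^[k] (hF.toLp F)) : Lp ℝ 2 μ)),
      Lp.coeFn_finsetSum (Finset.range N) (fun k => (id (K^[k] (hF.toLp F)) : Lp ℝ 2 μ))]
      with ω h1 h2 h3 h4
    rw [h2, h3, Pi.smul_apply, h4, Finset.sum_apply, hA, smul_eq_mul]
    exact congrArg _ (Finset.sum_congr rfl fun k _ => h1 k)
  obtain ⟨c, hc⟩ : ∃ c, (p : Ω → ℝ) =ᵐ[μ] Function.const Ω c := by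
    refine hT.ae_eq_const_of_ae_eq_comp_ae (Lp.aestronglyMeasurable p) ?_
    have : Lp.compMeasurePreserving T hTm p = p := hp
    exact (Lp.coeFn_compMeasurePreserving p hTm).symm.trans (by rw [this])
  have hL2 : Tendsto (fun N => eLpNorm (A N - Function.const Ω c) 2 μ) atTop (𝓝 0) := by
    have := (Lp.tendsto_Lp_iff_tendsto_eLpNorm' _ _).1 hlim
    refine this.congr fun N => eLpNorm_congr_ae ?_
    simp only [hbA]
    exact (hA2 N).coeFn_toLp.sub hc
  have hL1 : Tendsto (fun N => ∫⁻ ω, ‖A N ω - c‖ₑ ∂μ) atTop (𝓝 0) := by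
    refine tendsto_of_tendsto_of_tendsto_of_le_of_le tendsto_const_nhds hL2
      (fun _ => zero_le) fun N => ?_
    have := eLpNorm_le_eLpNorm_of_exponent_le (μ := μ) (p := 1) (q := 2) one_le_two
      ((hA2 N).sub (memLp_const c)).aestronglyMeasurable
    rw [eLpNorm_one_eq_lintegral_enorm] at this
    exact this
  have hmean : ∀ N, N ≠ 0 → ∫ ω, A N ω ∂μ = ∫ ω, F ω ∂μ := fun N hN => by
    have h1 : ∀ k, ∫ ω, F (T^[k] ω) ∂μ = ∫ ω, F ω ∂μ := fun k => by
      have hm := hTm.iterate k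
      conv_rhs => rw [← hm.map_eq]
      rw [integral_map hm.measurable.aemeasurable]
      rw [hm.map_eq]; exact hF.aestronglyMeasurable
    simp only [hA]
    rw [integral_const_mul, integral_finsetSum _ fun k _ => (hFk k).integrable one_le_two]
    simp only [h1, Finset.sum_const, Finset.card_range, nsmul_eq_mul]
    rw [inv_mul_cancel_left₀ (Nat.cast_ne_zero.2 hN)]
  have hcF : ∫ ω, F ω ∂μ = c := by
    have h2 : ∀ᶠ N : ℕ in atTop, ‖(∫ ω, F ω ∂μ) - c‖ₑ ≤ ∫⁻ ω, ‖A N ω - c‖ₑ ∂μ := by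
      filter_upwards [eventually_ne_atTop 0] with N hN
      refine le_trans (le_of_eq ?_) (enorm_integral_le_lintegral_enorm _)
      rw [integral_sub ((hA2 N).integrable one_le_two) (integrable_const c), hmean N hN]
      simp
    have h3 : ‖(∫ ω, F ω ∂μ) - c‖ₑ ≤ 0 := ge_of_tendsto hL1 h2
    exact sub_eq_zero.1 (enorm_eq_zero.1 (le_antisymm h3 zero_le))
  rw [hcF]
  exact hL1

end MeanErgodic

namespace MarkovChain

variable {S : Type*} [MeasurableSpace S] {Q : Kernel S S}

/-! ### The pointwise ergodic theorem for the Markov operator -/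

lemma lmarkovOp_mono {u v : S → ℝ≥0∞} (h : u ≤ v) : lmarkovOp Q u ≤ lmarkovOp Q v :=
  fun _ => lintegral_mono h

lemma lmarkovOp_iterate_mono {u v : S → ℝ≥0∞} (h : u ≤ v) (k : ℕ) :
    (lmarkovOp Q)^[k] u ≤ (lmarkovOp Q)^[k] v := by
  induction k generalizing u v with
  | zero => exact h
  | succ k ih => exact ih (lmarkovOp_mono h)

lemma lmarkovOp_add {u v : S → ℝ≥0∞} (hu : Measurable u) :
    lmarkovOp Q (u + v) = lmarkovOp Q u + lmarkovOp Q v :=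
  funext fun _ => lintegral_add_left hu _

lemma lmarkovOp_iterate_add {u v : S → ℝ≥0∞} (hu : Measurable u) (k : ℕ) :
    (lmarkovOp Q)^[k] (u + v) = (lmarkovOp Q)^[k] u + (lmarkovOp Q)^[k] v := by
  induction k generalizing u v with
  | zero => rfl
  | succ k ih =>
    simp only [Function.iterate_succ_apply]
    rw [lmarkovOp_add hu, ih (measurable_lmarkovOp hu)]

lemma lmarkovOp_iterate_sum {u : ℕ → S → ℝ≥0∞} (hu : ∀ i, Measurable (u i)) (n k : ℕ) :
    (lmarkovOp Q)^[k] (∑ i ∈ Finset.range n, u i)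
      = ∑ i ∈ Finset.range n, (lmarkovOp Q)^[k] (u i) := by
  induction n with
  | zero =>
    induction k with
    | zero => rfl
    | succ k ih =>
      rw [Function.iterate_succ_apply]
      have : lmarkovOp Q (∑ i ∈ Finset.range 0, u i) = ∑ i ∈ Finset.range 0, u i := by
        ext x; simp [lmarkovOp]
      rw [this, ih]; simp
  | succ n ih =>
    have hm : Measurable (∑ i ∈ Finset.range n, u i) := by
      rw [Finset.sum_fn]
      exact Finset.measurable_fun_sum _ fun i _ => hu i
    rw [Finset.sum_range_succ, Finset.sum_range_succ, lmarkovOp_iterate_add hm, ih]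

lemma lmarkovOp_iterate_const [IsMarkovKernel Q] (c : ℝ≥0∞) (k : ℕ) :
    (lmarkovOp Q)^[k] (fun _ => c) = fun _ => c := by
  induction k with
  | zero => rfl
  | succ k ih =>
    rw [Function.iterate_succ_apply]
    have : lmarkovOp Q (fun _ => c) = fun _ => c := by ext x; simp [lmarkovOp]
    rw [this, ih]

/-- The functions `Fₙ` with `F₀ = 0` and `Fₙ₊₁ = max (0, u - δ + Q Fₙ)`, the subtraction in
`[0, ∞]` being truncated at zero. They bound the excess over `n δ` of `u + Q u + ⋯ + Qⁿ⁻¹ u`, see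
`sum_le_excess_add`. -/
noncomputable def excess (Q : Kernel S S) (u : S → ℝ≥0∞) (δ : ℝ≥0∞) : ℕ → S → ℝ≥0∞
  | 0 => 0
  | n + 1 => fun x => u x + lmarkovOp Q (excess Q u δ n) x - δ

lemma measurable_excess {u : S → ℝ≥0∞} (hu : Measurable u) (δ : ℝ≥0∞) (n : ℕ) :
    Measurable (excess Q u δ n) := by
  induction n with
  | zero => exact measurable_const
  | succ n ih => exact (hu.add (measurable_lmarkovOp ih)).sub_const δ

lemma excess_le_succ (u : S → ℝ≥0∞) (δ : ℝ≥0∞) (n : ℕ) :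
    excess Q u δ n ≤ excess Q u δ (n + 1) := by
  induction n with
  | zero => exact fun _ => zero_le
  | succ n ih => exact fun x => tsub_le_tsub_right (add_le_add le_rfl (lmarkovOp_mono ih x)) δ

lemma sum_lmarkovOp_iterate_succ {u : S → ℝ≥0∞} (hu : Measurable u) (n : ℕ) (x : S) :
    ∑ i ∈ Finset.range (n + 1), (lmarkovOp Q)^[i] u x
      = u x + lmarkovOp Q (fun y => ∑ i ∈ Finset.range n, (lmarkovOp Q)^[i] u y) x := by
  rw [Finset.sum_range_succ', add_comm]
  simp only [Function.iterate_succ_apply', Function.iterate_zero_apply]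
  congr 1
  exact (lintegral_finsetSum _ fun i _ => measurable_lmarkovOp_iterate hu i).symm

lemma sum_le_excess_add [IsMarkovKernel Q] {u : S → ℝ≥0∞} (hu : Measurable u) (δ : ℝ≥0∞) (n : ℕ)
    (x : S) :
    ∑ i ∈ Finset.range n, (lmarkovOp Q)^[i] u x ≤ excess Q u δ n x + n * δ := by
  induction n generalizing x with
  | zero => simp
  | succ n ih =>
    rw [sum_lmarkovOp_iterate_succ hu]
    have h1 : lmarkovOp Q (fun y => ∑ i ∈ Finset.range n, (lmarkovOp Q)^[i] u y) x
        ≤ lmarkovOp Q (excess Q u δ n) x + n * δ := by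
      refine (lmarkovOp_mono (fun y => ih y) x).trans (le_of_eq ?_)
      refine (lintegral_add_left (measurable_excess hu δ n) _).trans ?_
      simp [lmarkovOp]
    calc _ ≤ u x + (lmarkovOp Q (excess Q u δ n) x + n * δ) := add_le_add le_rfl h1
      _ = (u x + lmarkovOp Q (excess Q u δ n) x) + n * δ := by ring
      _ ≤ (excess Q u δ (n + 1) x + δ) + n * δ := add_le_add le_tsub_add le_rfl
      _ = _ := by push_cast; ring

variable {π : Measure S}

/-- One step of the **maximal ergodic lemma**: on `{Fₙ₊₁ > 0}` one has `Fₙ₊₁ + δ = u + Q Fₙ`, and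
`∫ Q Fₙ = ∫ Fₙ ≤ ∫ Fₙ₊₁` by invariance. -/
lemma mul_measure_excess_pos_le [IsProbabilityMeasure π]
    (hinv : Kernel.Invariant Q π) {u : S → ℝ≥0∞} (hu : Measurable u)
    (hfin : ∫⁻ x, u x ∂π ≠ ∞) (δ : ℝ≥0∞) (n : ℕ) :
    δ * π {x | 0 < excess Q u δ n x} ≤ ∫⁻ x, u x ∂π := by
  have hF : ∀ n, ∫⁻ x, excess Q u δ n x ∂π ≠ ∞ := fun n => by
    induction n with
    | zero => simp [excess]
    | succ n ih =>
      refine ne_top_of_le_ne_top ?_ (lintegral_mono fun x => tsub_le_self)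
      rw [lintegral_add_left hu, lintegral_lmarkovOp hinv (measurable_excess hu δ n)]
      exact ENNReal.add_ne_top.2 ⟨hfin, ih⟩
  cases n with
  | zero => simp [excess]
  | succ n =>
    have hE : MeasurableSet {x | 0 < excess Q u δ (n + 1) x} :=
      measurableSet_lt measurable_const (measurable_excess hu δ (n + 1))
    have h1 : ∀ x, excess Q u δ (n + 1) x
        + {x | 0 < excess Q u δ (n + 1) x}.indicator (fun _ => δ) x
        ≤ u x + lmarkovOp Q (excess Q u δ n) x := fun x => by
      by_cases hx : 0 < excess Q u δ (n + 1) x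
      · rw [Set.indicator_of_mem (by exact hx)]
        exact (tsub_add_cancel_of_le (tsub_pos_iff_lt.1 hx).le).le
      · rw [Set.indicator_of_notMem (by exact hx), add_zero]
        exact tsub_le_self
    have h2 := lintegral_mono (μ := π) h1
    rw [lintegral_add_left (measurable_excess hu δ (n + 1)), lintegral_indicator_const hE,
      lintegral_add_left hu, lintegral_lmarkovOp hinv (measurable_excess hu δ n),
      add_comm (∫⁻ x, u x ∂π)] at h2
    exact (ENNReal.add_le_add_iff_left (hF (n + 1))).1
      (h2.trans (add_le_add (lintegral_mono (excess_le_succ u δ n)) le_rfl))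

/-- **Hopf's maximal ergodic inequality** for the Markov operator of an invariant measure. -/
theorem mul_measure_exists_lt_sum_le [IsMarkovKernel Q] [IsProbabilityMeasure π]
    (hinv : Kernel.Invariant Q π) {u : S → ℝ≥0∞} (hu : Measurable u)
    (hfin : ∫⁻ x, u x ∂π ≠ ∞) (δ : ℝ≥0∞) :
    δ * π {x | ∃ n : ℕ, n * δ < ∑ i ∈ Finset.range n, (lmarkovOp Q)^[i] u x} ≤ ∫⁻ x, u x ∂π := by
  have hsub : {x | ∃ n : ℕ, n * δ < ∑ i ∈ Finset.range n, (lmarkovOp Q)^[i] u x}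
      ⊆ ⋃ n, {x | 0 < excess Q u δ n x} := by
    rintro x ⟨n, hn⟩
    refine Set.mem_iUnion.2 ⟨n, ?_⟩
    by_contra h
    have h0 : excess Q u δ n x = 0 := by simpa using h
    have := sum_le_excess_add (Q := Q) hu δ n x
    rw [h0, zero_add] at this
    exact absurd hn this.not_gt
  have hmono : Monotone fun n => {x | 0 < excess Q u δ n x} :=
    monotone_nat_of_le_succ fun n x hx => lt_of_lt_of_le hx (excess_le_succ u δ n x)
  calc _ ≤ δ * π (⋃ n, {x | 0 < excess Q u δ n x}) := by gcongr
    _ = ⨆ n, δ * π {x | 0 < excess Q u δ n x} := by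
        rw [hmono.measure_iUnion, ENNReal.mul_iSup]
    _ ≤ _ := iSup_le fun n => mul_measure_excess_pos_le hinv hu hfin δ n

lemma measurable_shift : Measurable (shift (S := S)) :=
  measurable_pi_lambda _ fun n => measurable_pi_apply (n + 1)

lemma shift_iterate {S : Type*} (k : ℕ) (ω : ℕ → S) : (shift^[k] ω) 0 = ω k := by
  have : ∀ m, (shift^[k] ω) m = ω (k + m) := by
    induction k generalizing ω with
    | zero => simp
    | succ k ih =>
      intro m
      rw [Function.iterate_succ_apply, ih]
      exact congrArg ω (by omega)
  simpa using this 0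

variable [IsMarkovKernel Q] [IsProbabilityMeasure π]

/-- For a bounded function the ergodic averages over a long but fixed time are close to the mean,
in `L¹(π)`; the error `u` is the conditional expectation given `ξ₀` of the error in the mean
ergodic theorem on the path space. -/
lemma exists_sum_lmarkovOp_le_mul_lintegral_add (herg : IsErgodicChain Q π) {φ : S → ℝ≥0∞}
    (hφ : Measurable φ) {M : ℝ≥0∞} (hM : M ≠ ∞) (hb : ∀ x, φ x ≤ M) {ε : ℝ≥0∞} (hε : ε ≠ 0) :
    ∃ N : ℕ, N ≠ 0 ∧ ∃ u : S → ℝ≥0∞, Measurable u ∧ ∫⁻ x, u x ∂π ≤ ε ∧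
      ∀ x, ∑ k ∈ Finset.range N, (lmarkovOp Q)^[k] φ x ≤ N * (∫⁻ y, φ y ∂π + u x) := by
  set P : Measure (ℕ → S) := π.bind (pathLaw Q)
  have hPl : ∀ {G : (ℕ → S) → ℝ≥0∞}, Measurable G →
      ∫⁻ ω, G ω ∂P = ∫⁻ x, ∫⁻ ω, G ω ∂(pathLaw Q x) ∂π := fun hG =>
    Measure.lintegral_bind (pathLaw Q).aemeasurable hG.aemeasurable
  set F : (ℕ → S) → ℝ := fun ω => (φ (ω 0)).toReal with hF
  have hφtop : ∀ x, φ x ≠ ∞ := fun x => ne_top_of_le_ne_top hM (hb x)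
  have hFm : Measurable F := (hφ.comp (measurable_pi_apply 0)).ennreal_toReal
  have hF2 : MemLp F 2 P := MemLp.of_bound hFm.aestronglyMeasurable M.toReal
    (ae_of_all _ fun ω => by
      rw [Real.norm_of_nonneg ENNReal.toReal_nonneg]
      exact ENNReal.toReal_mono hM (hb _))
  have hmean : ENNReal.ofReal (∫ ω, F ω ∂P) = ∫⁻ x, φ x ∂π := by
    rw [ofReal_integral_eq_lintegral_ofReal (hF2.integrable one_le_two)
      (ae_of_all _ fun ω => ENNReal.toReal_nonneg)]
    simp only [hF, ENNReal.ofReal_toReal (hφtop _)]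
    rw [hPl (G := fun ω => φ (ω 0)) (hφ.comp (measurable_pi_apply 0))]
    simp only [lintegral_pathLaw_eval_zero hφ]
  have herg' : Ergodic (shift (S := S)) P := herg
  have hlim := herg'.tendsto_lintegral_average_sub hF2
  obtain ⟨N, hNε, hN⟩ := ((hlim.eventually_le_const (pos_iff_ne_zero.2 hε)).and
    (eventually_ne_atTop 0)).exists
  set c := ∫ ω, F ω ∂P
  set r : (ℕ → S) → ℝ≥0∞ := fun ω =>
    ‖(N : ℝ)⁻¹ * ∑ k ∈ Finset.range N, F (shift^[k] ω) - c‖ₑ with hr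
  have hrm : Measurable r := by
    refine Measurable.enorm (Measurable.sub_const (Measurable.const_mul ?_ _) c)
    exact Finset.measurable_fun_sum _ fun k _ => hFm.comp (measurable_shift.iterate k)
  refine ⟨N, hN, fun x => ∫⁻ ω, r ω ∂(pathLaw Q x), hrm.lintegral_kernel, ?_, fun x => ?_⟩
  · rw [← hPl hrm]; exact hNε
  · have hpt : ∀ ω : ℕ → S, ∑ k ∈ Finset.range N, φ (ω k) ≤ N * (∫⁻ y, φ y ∂π + r ω) := fun ω => by
      have hN' : (N : ℝ) ≠ 0 := Nat.cast_ne_zero.2 hN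
      have h1 : ∑ k ∈ Finset.range N, φ (ω k)
          = ENNReal.ofReal (∑ k ∈ Finset.range N, F (shift^[k] ω)) := by
        rw [ENNReal.ofReal_sum_of_nonneg fun k _ => ENNReal.toReal_nonneg]
        refine Finset.sum_congr rfl fun k _ => ?_
        simp only [shift_iterate, ENNReal.ofReal_toReal (hφtop _)]
      have h2 : ∑ k ∈ Finset.range N, F (shift^[k] ω)
          = N * (c + ((N : ℝ)⁻¹ * ∑ k ∈ Finset.range N, F (shift^[k] ω) - c)) := by
        field_simp
        ring
      rw [h1, h2, ENNReal.ofReal_mul (Nat.cast_nonneg N), ENNReal.ofReal_natCast, ← hmean]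
      gcongr
      refine ENNReal.ofReal_add_le.trans (add_le_add le_rfl ?_)
      simp only [hr, Real.enorm_eq_ofReal_abs]
      exact ENNReal.ofReal_le_ofReal (le_abs_self _)
    calc ∑ k ∈ Finset.range N, (lmarkovOp Q)^[k] φ x
        = ∫⁻ ω, ∑ k ∈ Finset.range N, φ (ω k) ∂(pathLaw Q x) := by
          rw [lintegral_finsetSum (f := fun k (ω : ℕ → S) => φ (ω k)) _
            fun k _ => hφ.comp (measurable_pi_apply k)]
          exact Finset.sum_congr rfl fun k _ => (lintegral_pathLaw_eval hφ x k).symm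
      _ ≤ ∫⁻ ω, N * (∫⁻ y, φ y ∂π + r ω) ∂(pathLaw Q x) := lintegral_mono hpt
      _ = N * (∫⁻ y, φ y ∂π + ∫⁻ ω, r ω ∂(pathLaw Q x)) := by
          rw [lintegral_const_mul' _ _ (ENNReal.natCast_ne_top N),
            lintegral_add_left measurable_const]
          simp

/-- The ergodic sums of an integrable function exceed `n` times its mean by at most a constant plus
the ergodic sums of a function of small integral. -/
lemma exists_sum_lmarkovOp_le (herg : IsErgodicChain Q π)
    {φ : S → ℝ≥0∞} (hφ : Measurable φ) (hfin : ∫⁻ x, φ x ∂π ≠ ∞) {ε : ℝ≥0∞} (hε : ε ≠ 0) :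
    ∃ C : ℝ≥0∞, C ≠ ∞ ∧ ∃ u : S → ℝ≥0∞, Measurable u ∧ ∫⁻ x, u x ∂π ≤ ε ∧
      ∀ (n : ℕ) (x : S), ∑ i ∈ Finset.range n, (lmarkovOp Q)^[i] φ x
        ≤ C + n * ∫⁻ y, φ y ∂π + ∑ i ∈ Finset.range n, (lmarkovOp Q)^[i] u x := by
  have hε2 : ε / 2 ≠ 0 := (ENNReal.half_pos hε).ne'
  -- Truncate `φ` at a level `M` at which little mass is lost.
  obtain ⟨M, hM⟩ : ∃ M : ℕ, ∫⁻ x, φ x ∂π ≤ ∫⁻ x, min (φ x) M ∂π + ε / 2 := by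
    have hsup : ∫⁻ x, φ x ∂π = ⨆ M : ℕ, ∫⁻ x, min (φ x) M ∂π := by
      rw [← lintegral_iSup (fun M => hφ.min measurable_const)
        fun a b hab x => min_le_min le_rfl (Nat.cast_le.2 hab)]
      refine lintegral_congr fun x => ?_
      rw [← inf_iSup_eq, ENNReal.iSup_natCast, inf_top_eq]
    by_contra! hcon
    have h1 : ∀ M : ℕ, ∫⁻ x, min (φ x) M ∂π ≤ ∫⁻ x, φ x ∂π - ε / 2 := fun M =>
      ENNReal.le_sub_of_add_le_right
        (ne_top_of_le_ne_top hfin (le_add_self.trans (hcon M).le)) (hcon M).le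
    have h2 : ∫⁻ x, φ x ∂π ≤ ∫⁻ x, φ x ∂π - ε / 2 := by
      conv_lhs => rw [hsup]
      exact iSup_le h1
    have h0 : ∫⁻ x, φ x ∂π ≠ 0 := fun h0 => by
      have := hcon 0; rw [h0] at this; exact not_lt_zero this
    exact absurd (ENNReal.sub_lt_self hfin h0 hε2) h2.not_gt
  set ψ : S → ℝ≥0∞ := fun x => min (φ x) M
  have hψm : Measurable ψ := hφ.min measurable_const
  have hψφ : ∀ x, ψ x ≤ φ x := fun x => min_le_left _ _
  have hψM : ∀ x, ψ x ≤ M := fun x => min_le_right _ _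
  have hψfin : ∫⁻ x, ψ x ∂π ≠ ∞ := ne_top_of_le_ne_top hfin (lintegral_mono hψφ)
  obtain ⟨N, hN, u, hu, huε, hNu⟩ := exists_sum_lmarkovOp_le_mul_lintegral_add herg hψm
    (ENNReal.natCast_ne_top M) hψM hε2
  refine ⟨N * M, ENNReal.mul_ne_top (ENNReal.natCast_ne_top N) (ENNReal.natCast_ne_top M),
    u + (φ - ψ), hu.add (hφ.sub hψm), ?_, fun n x => ?_⟩
  · refine (lintegral_add_left hu _).trans_le ?_
    rw [← ENNReal.add_halves ε]
    refine add_le_add huε ?_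
    refine (lintegral_sub hψm hψfin (ae_of_all _ hψφ)).trans_le ?_
    exact tsub_le_iff_left.2 hM
  -- A delay by `k < N` steps changes the ergodic sums of `ψ ≤ M` by at most `N M`.
  have hshift : ∀ k ∈ Finset.range N, ∑ i ∈ Finset.range n, (lmarkovOp Q)^[i] ψ x
      ≤ N * M + ∑ i ∈ Finset.range n, (lmarkovOp Q)^[i] ((lmarkovOp Q)^[k] ψ) x := fun k hk => by
    calc ∑ i ∈ Finset.range n, (lmarkovOp Q)^[i] ψ x
        ≤ ∑ i ∈ Finset.range (k + n), (lmarkovOp Q)^[i] ψ x :=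
          Finset.sum_le_sum_of_subset (Finset.range_mono (Nat.le_add_left n k))
      _ = ∑ i ∈ Finset.range k, (lmarkovOp Q)^[i] ψ x
          + ∑ i ∈ Finset.range n, (lmarkovOp Q)^[k + i] ψ x := Finset.sum_range_add _ _ _
      _ ≤ _ := by
          refine add_le_add ?_ (le_of_eq (Finset.sum_congr rfl fun i _ => ?_))
          · calc ∑ i ∈ Finset.range k, (lmarkovOp Q)^[i] ψ x
                ≤ ∑ i ∈ Finset.range k, (M : ℝ≥0∞) := by
                  refine Finset.sum_le_sum fun i _ => ?_
                  have := lmarkovOp_iterate_mono (Q := Q) hψM i x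
                  rwa [lmarkovOp_iterate_const] at this
              _ = k * M := by simp
              _ ≤ N * M := by
                  gcongr
                  exact_mod_cast (Finset.mem_range.1 hk).le
          · rw [add_comm k i, Function.iterate_add_apply]
  have hsum : (N : ℝ≥0∞) * ∑ i ∈ Finset.range n, (lmarkovOp Q)^[i] ψ x
      ≤ N * (N * M + n * ∫⁻ y, φ y ∂π + ∑ i ∈ Finset.range n, (lmarkovOp Q)^[i] u x) := by
    calc (N : ℝ≥0∞) * ∑ i ∈ Finset.range n, (lmarkovOp Q)^[i] ψ x
        = ∑ k ∈ Finset.range N, ∑ i ∈ Finset.range n, (lmarkovOp Q)^[i] ψ x := by simp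
      _ ≤ ∑ k ∈ Finset.range N,
            (N * M + ∑ i ∈ Finset.range n, (lmarkovOp Q)^[i] ((lmarkovOp Q)^[k] ψ) x) :=
          Finset.sum_le_sum hshift
      _ = N * (N * M) + ∑ i ∈ Finset.range n,
            ∑ k ∈ Finset.range N, (lmarkovOp Q)^[i] ((lmarkovOp Q)^[k] ψ) x := by
          rw [Finset.sum_add_distrib, Finset.sum_comm]
          simp
      _ ≤ N * (N * M) + ∑ i ∈ Finset.range n,
            N * (∫⁻ y, φ y ∂π + (lmarkovOp Q)^[i] u x) := by
          refine add_le_add le_rfl (Finset.sum_le_sum fun i _ => ?_)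
          have h1 : (∑ k ∈ Finset.range N, (lmarkovOp Q)^[k] ψ)
              ≤ ∑ k ∈ Finset.range N, ((fun _ => ∫⁻ y, φ y ∂π) + u) := fun y => by
            rw [Finset.sum_apply]
            refine (hNu y).trans ?_
            have : ∫⁻ y, ψ y ∂π ≤ ∫⁻ y, φ y ∂π := lintegral_mono hψφ
            simp only [Finset.sum_const, Finset.card_range, nsmul_eq_mul, Pi.mul_apply,
              Pi.add_apply, Pi.natCast_apply]
            gcongr
          have h2 := lmarkovOp_iterate_mono (Q := Q) h1 i x
          rw [lmarkovOp_iterate_sum fun k => measurable_lmarkovOp_iterate hψm k,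
            lmarkovOp_iterate_sum fun k => measurable_const.add hu,
            lmarkovOp_iterate_add measurable_const, lmarkovOp_iterate_const, Finset.sum_apply] at h2
          simpa [mul_add] using h2
      _ = _ := by
          rw [← Finset.mul_sum, Finset.sum_add_distrib]
          simp
          ring
  have hsum' := (ENNReal.mul_le_mul_iff_right (Nat.cast_ne_zero.2 hN)
    (ENNReal.natCast_ne_top N)).1 hsum
  have hsplit : φ = ψ + (φ - ψ) := funext fun y => (add_tsub_cancel_of_le (hψφ y)).symm
  calc ∑ i ∈ Finset.range n, (lmarkovOp Q)^[i] φ x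
      = ∑ i ∈ Finset.range n, (lmarkovOp Q)^[i] ψ x
        + ∑ i ∈ Finset.range n, (lmarkovOp Q)^[i] (φ - ψ) x := by
        rw [← Finset.sum_add_distrib]
        refine Finset.sum_congr rfl fun i _ => ?_
        conv_lhs => rw [hsplit]
        rw [lmarkovOp_iterate_add hψm, Pi.add_apply]
    _ ≤ _ := add_le_add hsum' le_rfl
    _ = _ := by
        rw [add_assoc _ (∑ i ∈ Finset.range n, (lmarkovOp Q)^[i] u x),
          ← Finset.sum_add_distrib]
        refine congrArg _ (Finset.sum_congr rfl fun i _ => ?_)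
        rw [lmarkovOp_iterate_add hu, Pi.add_apply]

/-- The upper half of **Hopf's ergodic theorem** for the Markov operator of an ergodic chain. -/
theorem ae_limsup_sum_lmarkovOp_div_le (hinv : Kernel.Invariant Q π) (herg : IsErgodicChain Q π)
    {φ : S → ℝ≥0∞} (hφ : Measurable φ) (hfin : ∫⁻ x, φ x ∂π ≠ ∞) :
    ∀ᵐ x ∂π, limsup (fun n : ℕ => (∑ i ∈ Finset.range n, (lmarkovOp Q)^[i] φ x) / (n : ℝ≥0∞)) atTop
      ≤ ∫⁻ y, φ y ∂π := by
  set c := ∫⁻ y, φ y ∂π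
  set L : S → ℝ≥0∞ := fun x =>
    limsup (fun n : ℕ => (∑ i ∈ Finset.range n, (lmarkovOp Q)^[i] φ x) / (n : ℝ≥0∞)) atTop
  have key : ∀ δ : ℝ≥0∞, δ ≠ 0 → δ ≠ ∞ → ∀ᵐ x ∂π, L x ≤ c + δ := fun δ hδ hδ' => by
    rw [ae_iff]
    refine le_antisymm (ENNReal.le_of_forall_pos_le_add fun ε hε _ => ?_) zero_le
    rw [zero_add]
    have hε0 : δ * (ε : ℝ≥0∞) ≠ 0 := mul_ne_zero hδ (by exact_mod_cast hε.ne')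
    obtain ⟨C, hC, u, hu, huε, hbound⟩ := exists_sum_lmarkovOp_le herg hφ hfin hε0
    have hsub : {x | ¬ L x ≤ c + δ}
        ⊆ {x | ∃ n : ℕ, n * δ < ∑ i ∈ Finset.range n, (lmarkovOp Q)^[i] u x} := by
      intro x hx
      by_contra hcon
      have hcon' : ∀ n : ℕ, ∑ i ∈ Finset.range n, (lmarkovOp Q)^[i] u x ≤ n * δ := by
        simpa using hcon
      apply hx
      have hC0 : Tendsto (fun n : ℕ => C / (n : ℝ≥0∞)) atTop (nhds 0) := by
        simpa using ENNReal.Tendsto.const_div ENNReal.tendsto_nat_nhds_top (Or.inr hC)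
      have hlim : Tendsto (fun n : ℕ => C / (n : ℝ≥0∞) + (c + δ)) atTop (nhds (0 + (c + δ))) :=
        hC0.add tendsto_const_nhds
      rw [zero_add] at hlim
      refine le_trans (limsup_le_limsup ?_) hlim.limsup_eq.le
      filter_upwards [eventually_ne_atTop 0] with n hn
      have hn' : (n : ℝ≥0∞) ≠ 0 := Nat.cast_ne_zero.2 hn
      calc (∑ i ∈ Finset.range n, (lmarkovOp Q)^[i] φ x) / (n : ℝ≥0∞)
          ≤ (C + n * c + n * δ) / n := by
            gcongr
            exact (hbound n x).trans (add_le_add le_rfl (hcon' n))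
        _ = C / n + (c + δ) := by
            rw [add_assoc, ← mul_add, ENNReal.add_div,
              mul_comm, ENNReal.mul_div_cancel_right hn' (ENNReal.natCast_ne_top n)]
    have hmax := mul_measure_exists_lt_sum_le hinv hu
      (ne_top_of_le_ne_top (ENNReal.mul_ne_top hδ' ENNReal.coe_ne_top) huε) δ
    exact (measure_mono hsub).trans
      ((ENNReal.mul_le_mul_iff_right hδ hδ').1 (hmax.trans huε))
  have hall : ∀ᵐ x ∂π, ∀ m : ℕ, L x ≤ c + ((m : ℝ≥0∞) + 1)⁻¹ := ae_all_iff.2 fun m =>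
    key _ (ENNReal.inv_ne_zero.2 (by finiteness)) (ENNReal.inv_ne_top.2 (by simp))
  filter_upwards [hall] with x hx
  have hlim : Tendsto (fun m : ℕ => c + ((m : ℝ≥0∞) + 1)⁻¹) atTop (nhds (c + 0)) := by
    refine tendsto_const_nhds.add ?_
    exact_mod_cast (tendsto_add_atTop_iff_nat 1).2 ENNReal.tendsto_inv_nat_nhds_zero
  rw [add_zero] at hlim
  exact ge_of_tendsto' hlim hx

end MarkovChain

namespace MarkovChain

variable {S : Type*} [MeasurableSpace S] {Q : Kernel S S} [IsMarkovKernel Q] {π : Measure S}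

/-! ### The maximal inequality along the chain -/

lemma memLp_two_iff_lintegral {α : Type*} [MeasurableSpace α] {μ : Measure α} {f : α → ℝ}
    (hf : Measurable f) : MemLp f 2 μ ↔ ∫⁻ x, ‖f x‖ₑ ^ 2 ∂μ < ∞ := by
  rw [MemLp, and_iff_right hf.aestronglyMeasurable,
    eLpNorm_lt_top_iff_lintegral_rpow_enorm_lt_top two_ne_zero ENNReal.ofNat_ne_top]
  simp

lemma enorm_markovOp_sq_le {f : S → ℝ} (hf : Measurable f) (x : S) :
    ‖markovOp Q f x‖ₑ ^ 2 ≤ lmarkovOp Q (fun y => ‖f y‖ₑ ^ 2) x := by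
  have h1 : ‖markovOp Q f x‖ₑ ≤ eLpNorm f 2 (Q x) := by
    refine (enorm_integral_le_lintegral_enorm f).trans ?_
    rw [← eLpNorm_one_eq_lintegral_enorm]
    exact eLpNorm_le_eLpNorm_of_exponent_le one_le_two hf.aestronglyMeasurable
  refine (pow_le_pow_left' h1 2).trans (le_of_eq ?_)
  have := eLpNorm_nnreal_pow_eq_lintegral (μ := Q x) (f := f) (p := 2) two_ne_zero
  simpa [lmarkovOp] using this

lemma lintegral_enorm_markovOp_iterate_sq_le (hinv : Kernel.Invariant Q π) {f : S → ℝ}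
    (hf : Measurable f) (i : ℕ) :
    ∫⁻ x, ‖(markovOp Q)^[i] f x‖ₑ ^ 2 ∂π ≤ ∫⁻ x, ‖f x‖ₑ ^ 2 ∂π := by
  induction i generalizing f with
  | zero => exact le_rfl
  | succ i ih =>
    calc _ ≤ ∫⁻ x, ‖markovOp Q f x‖ₑ ^ 2 ∂π := ih (measurable_markovOp hf)
      _ ≤ ∫⁻ x, lmarkovOp Q (fun y => ‖f y‖ₑ ^ 2) x ∂π :=
          lintegral_mono fun x => enorm_markovOp_sq_le hf x
      _ = _ := lintegral_lmarkovOp hinv (hf.enorm.pow_const 2)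

lemma ae_memLp_pathLaw (hinv : Kernel.Invariant Q π) {f : S → ℝ} (hf : Measurable f)
    (hf2 : MemLp f 2 π) :
    ∀ᵐ x ∂π, ∀ i k, MemLp (fun ω : ℕ → S => (markovOp Q)^[i] f (ω k)) 2 (pathLaw Q x) := by
  refine ae_all_iff.2 fun i => ae_all_iff.2 fun k => ?_
  have hm := measurable_markovOp_iterate (Q := Q) hf i
  have hsq : Measurable fun y => ‖(markovOp Q)^[i] f y‖ₑ ^ 2 := hm.enorm.pow_const 2
  have hlt : ∫⁻ x, (lmarkovOp Q)^[k] (fun y => ‖(markovOp Q)^[i] f y‖ₑ ^ 2) x ∂π ≠ ∞ := by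
    rw [lintegral_lmarkovOp_iterate hinv hsq]
    exact ((lintegral_enorm_markovOp_iterate_sq_le hinv hf i).trans_lt
      ((memLp_two_iff_lintegral hf).1 hf2)).ne
  filter_upwards [ae_lt_top (measurable_lmarkovOp_iterate hsq k) hlt] with x hx
  rw [← lintegral_pathLaw_eval hsq x k] at hx
  exact (memLp_two_iff_lintegral (hm.comp (measurable_pi_apply k))).2 hx

lemma measurable_supPotential {f : S → ℝ} (hf : Measurable f) :
    Measurable (supPotential Q f) :=
  Measurable.iSup fun _ => ENNReal.measurable_ofReal.comp
    (Finset.measurable_fun_sum _ fun j _ => measurable_markovOp_iterate hf j).abs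

lemma measurable_abs_mul_supPotential {f : S → ℝ} (hf : Measurable f) :
    Measurable fun y => ENNReal.ofReal |f y| * supPotential Q f y :=
  (ENNReal.measurable_ofReal.comp hf.abs).mul (measurable_supPotential hf)

lemma markovOp_iterate_neg {Q : Kernel S S} (f : S → ℝ) (j : ℕ) :
    (markovOp Q)^[j] (-f) = -(markovOp Q)^[j] f := by
  induction j generalizing f with
  | zero => rfl
  | succ j ih =>
    have : markovOp Q (-f) = -markovOp Q f := funext fun x => integral_neg f
    rw [Function.iterate_succ_apply, this, ih, Function.iterate_succ_apply]

lemma supPotential_neg {Q : Kernel S S} (f : S → ℝ) : supPotential Q (-f) = supPotential Q f := by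
  ext x
  simp only [supPotential, markovOp_iterate_neg, Pi.neg_apply, Finset.sum_neg_distrib, abs_neg]

/-- The maximal inequality for `Xₖ = f(ξₖ₊₁)` under `ℙˣ`: by the Markov property, the conditional
expectation of `f(ξₖ₊₁) + ⋯ + f(ξₙ)` given the past up to time `k + 1` is
`(f + Q f + ⋯ + Qⁿ⁻ᵏ⁻¹ f)(ξₖ₊₁)`, which `supPotential` bounds. -/
lemma lintegral_runMax_sq_le {f : S → ℝ} (hf : Measurable f) {x : S}
    (h2 : ∀ i k, MemLp (fun ω : ℕ → S => (markovOp Q)^[i] f (ω k)) 2 (pathLaw Q x)) (n : ℕ) :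
    ∫⁻ ω, ENNReal.ofReal (runMax (fun i => f (ω (i + 1))) n ^ 2) ∂(pathLaw Q x)
      ≤ 8 * ∑ k ∈ Finset.range n,
        (lmarkovOp Q)^[k + 1] (fun y => ENNReal.ofReal |f y| * supPotential Q f y) x := by
  set ℱ : Filtration ℕ (inferInstance : MeasurableSpace (ℕ → S)) :=
    { seq := fun k => Filtration.piLE (X := fun _ : ℕ => S) (k + 1)
      mono' := fun _ _ h => (Filtration.piLE (X := fun _ : ℕ => S)).mono (Nat.succ_le_succ h)
      le' := fun k => (Filtration.piLE (X := fun _ : ℕ => S)).le (k + 1) }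
  set X : ℕ → (ℕ → S) → ℝ := fun k ω => f (ω (k + 1))
  have hX2 : ∀ k, MemLp (X k) 2 (pathLaw Q x) := fun k => h2 0 (k + 1)
  have hXm : ∀ k, StronglyMeasurable[ℱ k] (X k) := fun k => by
    change StronglyMeasurable[Filtration.piLE (X := fun _ : ℕ => S) (k + 1)] (X k)
    rw [Filtration.piLE_eq_comap_frestrictLe]
    exact ((hf.comp (measurable_pi_apply ⟨k + 1, Finset.mem_Iic.2 le_rfl⟩)).comp
      (comap_measurable (Preorder.frestrictLe (π := fun _ : ℕ => S) (k + 1)))).stronglyMeasurable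
  have hmain := integral_runMax_sq_le (ℱ := ℱ) hXm hX2 n
  rw [← ofReal_integral_eq_lintegral_ofReal (memLp_runMax hX2 n).integrable_sq
    (ae_of_all _ fun ω => sq_nonneg _)]
  refine (ENNReal.ofReal_le_ofReal hmain).trans ?_
  rw [ENNReal.ofReal_sum_of_nonneg fun k _ => mul_nonneg (by norm_num)
    (integral_nonneg fun ω => mul_nonneg (abs_nonneg _) (abs_nonneg _)), Finset.mul_sum]
  refine Finset.sum_le_sum fun k hk => ?_
  have hk := Finset.mem_range.1 hk
  rw [ENNReal.ofReal_mul (by norm_num), ENNReal.ofReal_ofNat,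
    ← lintegral_pathLaw_eval (measurable_abs_mul_supPotential hf)]
  gcongr
  have hT2 : MemLp (fun ω => ∑ i ∈ Finset.Ico k n, X i ω) 2 (pathLaw Q x) :=
    memLp_finsetSum _ fun i _ => hX2 i
  have hint : Integrable (fun ω => |X k ω| *
      |((pathLaw Q x)[fun ω => ∑ i ∈ Finset.Ico k n, X i ω | ℱ k]) ω|) (pathLaw Q x) :=
    (hX2 k).abs.integrable_mul (hT2.condExp one_le_two).abs
  rw [ofReal_integral_eq_lintegral_ofReal hint
    (ae_of_all _ fun ω => mul_nonneg (abs_nonneg _) (abs_nonneg _))]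
  refine lintegral_mono_ae ?_
  have hsum : (pathLaw Q x)[fun ω => ∑ i ∈ Finset.Ico k n, X i ω | ℱ k]
      =ᵐ[pathLaw Q x] ∑ i ∈ Finset.Ico k n, (pathLaw Q x)[X i | ℱ k] := by
    have := condExp_finsetSum (μ := pathLaw Q x) (s := Finset.Ico k n) (f := X)
      (fun i _ => (hX2 i).integrable one_le_two) (ℱ k)
    rwa [Finset.sum_fn] at this
  have hterm : ∀ᵐ ω ∂(pathLaw Q x), ∀ j,
      ((pathLaw Q x)[X (k + j) | ℱ k]) ω = (markovOp Q)^[j] f (ω (k + 1)) :=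
    ae_all_iff.2 fun j => by
      have := condExp_pathLaw_add hf x (fun i k => (h2 i k).integrable one_le_two) (k + 1) j
      rwa [add_right_comm k 1 j] at this
  filter_upwards [hsum, hterm] with ω h3 h4
  rw [h3, Finset.sum_apply, ENNReal.ofReal_mul (abs_nonneg _)]
  gcongr
  obtain ⟨m, hm⟩ : ∃ m, n - k = m + 1 := ⟨n - k - 1, by omega⟩
  rw [Finset.sum_Ico_eq_sum_range, hm, Finset.sum_congr rfl fun j _ => h4 j]
  exact le_iSup (fun m => ENNReal.ofReal
    |∑ j ∈ Finset.range (m + 1), (markovOp Q)^[j] f (ω (k + 1))|) m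

lemma partialSum_eq_sum_range {S : Type*} (f : S → ℝ) (n : ℕ) (ω : ℕ → S) :
    partialSum f n ω = ∑ i ∈ Finset.range n, f (ω (i + 1)) := by
  induction n with
  | zero => simp [partialSum]
  | succ n ih =>
    rw [Finset.sum_range_succ, ← ih, partialSum, partialSum, Finset.sum_Icc_succ_top (by omega)]

lemma maxSqSum_le {S : Type*} (f : S → ℝ) (n : ℕ) (ω : ℕ → S) :
    maxSqSum f n ω ≤ ENNReal.ofReal (runMax (fun i => f (ω (i + 1))) n ^ 2)
      + ENNReal.ofReal (runMax (fun i => (-f) (ω (i + 1))) n ^ 2) := by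
  refine Finset.sup_le fun k hk => ?_
  have hkn := (Finset.mem_Icc.1 hk).2
  rw [partialSum_eq_sum_range]
  have h1 := (sum_le_runMax (fun i => f (ω (i + 1))) k).trans (runMax_mono _ hkn)
  have h2 := (sum_le_runMax (fun i => (-f) (ω (i + 1))) k).trans (runMax_mono _ hkn)
  simp only [Pi.neg_apply, Finset.sum_neg_distrib] at h2
  rcases le_total 0 (∑ i ∈ Finset.range k, f (ω (i + 1))) with h | h
  · exact le_add_right (ENNReal.ofReal_le_ofReal (pow_le_pow_left₀ h h1 2))
  · refine le_add_left (ENNReal.ofReal_le_ofReal ?_)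
    rw [← neg_sq]
    exact pow_le_pow_left₀ (neg_nonneg.2 h) h2 2

/-- The maximal inequality under `ℙˣ` for almost every starting point `x`. The exceptional set
consists of the points from which some `(Qⁱ f)(ξₖ)` fails to be square integrable. The two signs of
the partial sums contribute `8` each to the constant. -/
theorem ae_lintegral_maxSqSum_le (hinv : Kernel.Invariant Q π) {f : S → ℝ} (hf : Measurable f)
    (hf2 : MemLp f 2 π) :
    ∀ᵐ x ∂π, ∀ n, ∫⁻ ω, maxSqSum f n ω ∂(pathLaw Q x) ≤ 16 * ∑ k ∈ Finset.range n,
      (lmarkovOp Q)^[k] (lmarkovOp Q fun y => ENNReal.ofReal |f y| * supPotential Q f y) x := by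
  filter_upwards [ae_memLp_pathLaw hinv hf hf2, ae_memLp_pathLaw hinv hf.neg hf2.neg]
    with x hx hx' n
  have h1 := lintegral_runMax_sq_le hf hx n
  have h2 := lintegral_runMax_sq_le hf.neg hx' n
  simp only [Pi.neg_apply, abs_neg, supPotential_neg] at h2
  have hm : Measurable fun ω : ℕ → S => ENNReal.ofReal (runMax (fun i => f (ω (i + 1))) n ^ 2) :=
    ENNReal.measurable_ofReal.comp ((stronglyMeasurable_runMax (X := fun i (ω : ℕ → S) =>
      f (ω (i + 1))) fun k _ =>
        (hf.comp (measurable_pi_apply _)).stronglyMeasurable).measurable.pow_const 2)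
  calc _ ≤ _ := lintegral_mono fun ω => maxSqSum_le f n ω
    _ = _ := lintegral_add_left hm _
    _ ≤ _ := add_le_add h1 h2
    _ = _ := by
      simp only [Function.iterate_succ_apply]
      rw [← add_mul]
      norm_num

end MarkovChain

theorem proposition1 {S : Type*} [MeasurableSpace S]
    (Q : Kernel S S) [IsMarkovKernel Q] (π : Measure S) [IsProbabilityMeasure π]
    (hinv : Kernel.Invariant Q π) (herg : MarkovChain.IsErgodicChain Q π)
    (h : S → ℝ) (hh : MarkovChain.MemLp0 h 2 π)
    (hfin : ∫⁻ x, ENNReal.ofReal |h x| * MarkovChain.supPotential Q h x ∂π < ∞) :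
    ∀ᵐ x ∂π,
      limsup (fun n : ℕ =>
          (∫⁻ ω, MarkovChain.maxSqSum h n ω ∂(MarkovChain.pathLaw Q x)) / (n : ℝ≥0∞)) atTop
        ≤ 24 * ∫⁻ x, ENNReal.ofReal |h x| * MarkovChain.supPotential Q h x ∂π := by
  obtain ⟨hm, h2, -⟩ := hh
  have hφ := MarkovChain.measurable_abs_mul_supPotential (Q := Q) hm
  have hint := MarkovChain.lintegral_lmarkovOp hinv hφ
  have hlim := MarkovChain.ae_limsup_sum_lmarkovOp_div_le hinv herg
    (MarkovChain.measurable_lmarkovOp hφ) (hint.trans_lt hfin).ne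
  rw [hint] at hlim
  filter_upwards [MarkovChain.ae_lintegral_maxSqSum_le hinv hm h2, hlim] with x h1 h3
  calc _ ≤ _ := limsup_le_limsup (Eventually.of_forall fun n =>
        (ENNReal.div_le_div_right (h1 n) (n : ℝ≥0∞)).trans_eq (mul_div_assoc _ _ _))
    _ = _ := ENNReal.limsup_const_mul_of_ne_top (by norm_num)
    _ ≤ 16 * _ := by gcongr
    _ ≤ _ := by gcongr; norm_num
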